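/- Let $\kappa$ be an infinite regular cardinal. A $\kappa$-Boolean algebra is a Boolean algebra in which every subset of cardinality $<\kappa$ has a join (hence also a meet); homomorphisms of $\kappa$-Boolean algebras are Boolean homomorphisms preserving joins of sets of cardinality $<\kappa$. For a set $X$, let $\mathcal K(X)$ be the free $\kappa$-Boolean algebra generated by $X$, whose generators are identified with the elements of $X$, and for a map $f : X \to Y$ let $f_* : \mathcal K(X) \to \mathcal K(Y)$ be the homomorphism extending $f$. Write $a \leftrightarrow b := (\neg a \vee b) \wedge (\neg b \vee a)$. Let $X$ be a set of cardinality $<\kappa$, let $Z \subseteq X$ with inclusion $i : Z \hookrightarrow X$, and let $f, g : X \to X \sqcup_Z X$ be the two coprojections of a pushout of $i$ with itself in the category of sets, so that $f \circ i = g \circ i$. Let $b \in \mathcal K(X)$ be such that $$f_*(b) \wedge g_*(b) \le \bigwedge_{y \in X \setminus Z} \bigl(f(y) \leftrightarrow g(y)\bigr) \quad \text{in } \mathcal K(X \sqcup_Z X).$$ Then there is a homomorphism of $\kappa$-Boolean algebras $h : \mathcal K(X) \to \mathcal K(Z)$ with $h \circ i_* = \mathrm{id}_{\mathcal K(Z)}$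 such that $$b = i_*(h(b)) \wedge \bigwedge_{y \in X \setminus Z} \bigl(i_*(h(y)) \leftrightarrow y\bigr) \quad \text{in } \mathcal K(X).$$ -/

import Mathlib

open Cardinal CategoryTheory
open scoped symmDiff

universe u

/-! ## `κ`-complete Boolean algebras -/

/-- A Boolean algebra is `κ`-complete if every subset of cardinality `< κ` has a join. -/
class KComplete (κ : Cardinal.{u}) (A : Type u) [BooleanAlgebra A] : Prop where
  exists_isLUB : ∀ S : Set A, #S < κ → ∃ a : A, IsLUB S a

namespace KComplete

variable (κ : Cardinal.{u}) {A : Type u} [BooleanAlgebra A] [KComplete κ A]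

theorem exists_isLUB_range {ι : Type u} (hι : #ι < κ) (a : ι → A) :
    ∃ s : A, IsLUB (Set.range a) s :=
  exists_isLUB (κ := κ) (Set.range a) (mk_range_le.trans_lt hι)

theorem exists_isGLB_range {ι : Type u} (hι : #ι < κ) (a : ι → A) :
    ∃ s : A, IsGLB (Set.range a) s := by
  obtain ⟨s, hs⟩ := exists_isLUB_range κ hι (fun i => (a i)ᶜ)
  refine ⟨sᶜ, ?_, ?_⟩
  · rintro _ ⟨i, rfl⟩
    have h : (a i)ᶜ ≤ s := hs.1 ⟨i, rfl⟩
    exact compl_le_of_compl_le h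
  · intro t ht
    apply le_compl_of_le_compl
    apply hs.2
    rintro _ ⟨i, rfl⟩
    exact compl_le_compl (ht ⟨i, rfl⟩)

/-- The join of a family indexed by a set of cardinality `< κ`. -/
noncomputable def kSup {ι : Type u} (hι : #ι < κ) (a : ι → A) : A :=
  Classical.choose (exists_isLUB_range κ hι a)

theorem isLUB_kSup {ι : Type u} (hι : #ι < κ) (a : ι → A) :
    IsLUB (Set.range a) (kSup κ hι a) :=
  Classical.choose_spec (exists_isLUB_range κ hι a)

/-- The meet of a family indexed by a set of cardinality `< κ`. -/
noncomputable def kInf {ι : Type u} (hι : #ι < κ) (a : ι → A) : A :=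
  Classical.choose (exists_isGLB_range κ hι a)

theorem isGLB_kInf {ι : Type u} (hι : #ι < κ) (a : ι → A) :
    IsGLB (Set.range a) (kInf κ hι a) :=
  Classical.choose_spec (exists_isGLB_range κ hι a)

end KComplete

/-- Homomorphisms of `κ`-complete Boolean algebras: Boolean homomorphisms (a bounded lattice
homomorphism between Boolean algebras preserves complements) that preserve joins of sets of
cardinality `< κ`. -/
structure KBoolHom (κ : Cardinal.{u}) (A B : Type u) [BooleanAlgebra A] [BooleanAlgebra B]
    extends BoundedLatticeHom A B where
  map_isLUB' : ∀ (S : Set A) (a : A), #S < κ → IsLUB S a → IsLUB (toFun '' S) (toFun a)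

instance KBoolHom.instFunLike (κ : Cardinal.{u}) (A B : Type u)
    [BooleanAlgebra A] [BooleanAlgebra B] : FunLike (KBoolHom κ A B) A B where
  coe f := f.toFun
  coe_injective f g h := by
    obtain ⟨f, hf⟩ := f
    obtain ⟨g, hg⟩ := g
    have : f = g := DFunLike.coe_injective h
    subst this
    rfl

/-! ## Free `κ`-complete Boolean algebras -/

/-- Terms in the language of `κ`-complete Boolean algebras with variables from `X`. Up to
bijection, the index sets of cardinality `< κ` are the subsets of cardinality `< κ` of a
fixed set `κ.out` of cardinality `κ`. -/
inductive KTerm (κ : Cardinal.{u}) (X : Type u) : Type u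
  | var (x : X) : KTerm κ X
  | bot : KTerm κ X
  | top : KTerm κ X
  | compl (s : KTerm κ X) : KTerm κ X
  | inf (s t : KTerm κ X) : KTerm κ X
  | sup (s t : KTerm κ X) : KTerm κ X
  | kSup (I : Set κ.out) (hI : #I < κ) (s : I → KTerm κ X) : KTerm κ X

/-- The preorder on terms generated by the axioms of `κ`-complete Boolean algebras. -/
inductive KTerm.Le {κ : Cardinal.{u}} {X : Type u} : KTerm κ X → KTerm κ X → Prop
  | refl (s) : Le s s
  | trans {s t r} : Le s t → Le t r → Le s r
  | bot_le (s) : Le bot s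
  | le_top (s) : Le s top
  | inf_le_left (s t) : Le (inf s t) s
  | inf_le_right (s t) : Le (inf s t) t
  | le_inf {s t r} : Le s t → Le s r → Le s (inf t r)
  | le_sup_left (s t) : Le s (sup s t)
  | le_sup_right (s t) : Le t (sup s t)
  | sup_le {s t r} : Le s r → Le t r → Le (sup s t) r
  | distrib (s t r) : Le (inf s (sup t r)) (sup (inf s t) (inf s r))
  | inf_compl_le_bot (s) : Le (inf s (compl s)) bot
  | top_le_sup_compl (s) : Le top (sup s (compl s))
  | le_kSup (I : Set κ.out) (hI : #I < κ) (s : I → KTerm κ X) (i : I) : Le (s i) (kSup I hI s)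
  | kSup_le (I : Set κ.out) (hI : #I < κ) (s : I → KTerm κ X) (t) :
      (∀ i, Le (s i) t) → Le (kSup I hI s) t

namespace KTerm

variable {κ : Cardinal.{u}} {X : Type u}

theorem Le.compl_anti {s t : KTerm κ X} (h : Le s t) : Le (compl t) (compl s) :=
  have h1 : Le (compl t) (inf (compl t) (sup s (compl s))) :=
    .le_inf (.refl _) (.trans (.le_top _) (.top_le_sup_compl s))
  have h2 : Le (inf (compl t) s) (compl s) :=
    .trans (.trans (.le_inf (.trans (.inf_le_right _ _) h) (.inf_le_left _ _))
      (.inf_compl_le_bot t)) (.bot_le _)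
  .trans h1 (.trans (.distrib _ _ _) (.sup_le h2 (.inf_le_right _ _)))

/-- Two terms are identified when the axioms prove them equal. -/
def setoid (κ : Cardinal.{u}) (X : Type u) : Setoid (KTerm κ X) where
  r s t := Le s t ∧ Le t s
  iseqv :=
    { refl := fun s => ⟨.refl s, .refl s⟩
      symm := fun h => ⟨h.2, h.1⟩
      trans := fun h k => ⟨.trans h.1 k.1, .trans k.2 h.2⟩ }

end KTerm

/-- The free `κ`-complete Boolean algebra on `X`. -/
def FreeKBool (κ : Cardinal.{u}) (X : Type u) : Type u := Quotient (KTerm.setoid κ X)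

namespace FreeKBool

open KTerm

variable {κ : Cardinal.{u}} {X Y : Type u}

/-- The class of a term. -/
def mk (s : KTerm κ X) : FreeKBool κ X := Quotient.mk (KTerm.setoid κ X) s

instance instBooleanAlgebra : BooleanAlgebra (FreeKBool κ X) where
  le := Quotient.lift₂ Le fun _ _ _ _ h k =>
    propext ⟨fun l => .trans h.2 (.trans l k.1), fun l => .trans h.1 (.trans l k.2)⟩
  le_refl := by rintro ⟨s⟩; exact Le.refl s
  le_trans := by rintro ⟨s⟩ ⟨t⟩ ⟨r⟩ h k; exact Le.trans h k
  le_antisymm := by rintro ⟨s⟩ ⟨t⟩ h k; exact Quotient.sound ⟨h, k⟩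
  bot := mk .bot
  top := mk .top
  compl := Quotient.lift (fun s => mk (.compl s)) fun _ _ h =>
    Quotient.sound ⟨Le.compl_anti h.2, Le.compl_anti h.1⟩
  inf := Quotient.lift₂ (fun s t => mk (.inf s t)) fun _ _ _ _ h k => Quotient.sound
    ⟨.le_inf (.trans (.inf_le_left _ _) h.1) (.trans (.inf_le_right _ _) k.1),
      .le_inf (.trans (.inf_le_left _ _) h.2) (.trans (.inf_le_right _ _) k.2)⟩
  sup := Quotient.lift₂ (fun s t => mk (.sup s t)) fun _ _ _ _ h k => Quotient.sound
    ⟨.sup_le (.trans h.1 (.le_sup_left _ _)) (.trans k.1 (.le_sup_right _ _)),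
      .sup_le (.trans h.2 (.le_sup_left _ _)) (.trans k.2 (.le_sup_right _ _))⟩
  inf_le_left := by rintro ⟨s⟩ ⟨t⟩; exact Le.inf_le_left s t
  inf_le_right := by rintro ⟨s⟩ ⟨t⟩; exact Le.inf_le_right s t
  le_inf := by rintro ⟨s⟩ ⟨t⟩ ⟨r⟩ h k; exact Le.le_inf h k
  le_sup_left := by rintro ⟨s⟩ ⟨t⟩; exact Le.le_sup_left s t
  le_sup_right := by rintro ⟨s⟩ ⟨t⟩; exact Le.le_sup_right s t
  sup_le := by rintro ⟨s⟩ ⟨t⟩ ⟨r⟩ h k; exact Le.sup_le h k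
  le_sup_inf := by
    rintro ⟨s⟩ ⟨t⟩ ⟨r⟩
    refine Le.trans (.distrib _ _ _) (.sup_le (.trans (.inf_le_right _ _) (.le_sup_left _ _)) ?_)
    refine Le.trans (.le_inf (.inf_le_right _ _) (.inf_le_left _ _)) ?_
    refine Le.trans (.distrib _ _ _) (.sup_le (.trans (.inf_le_right _ _) (.le_sup_left _ _)) ?_)
    exact .trans (.le_inf (.inf_le_right _ _) (.inf_le_left _ _)) (.le_sup_right _ _)
  inf_compl_le_bot := by rintro ⟨s⟩; exact Le.inf_compl_le_bot s
  top_le_sup_compl := by rintro ⟨s⟩; exact Le.top_le_sup_compl s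
  le_top := by rintro ⟨s⟩; exact Le.le_top s
  bot_le := by rintro ⟨s⟩; exact Le.bot_le s

theorem mk_le_mk {s t : KTerm κ X} : mk s ≤ mk t ↔ Le s t := Iff.rfl

theorem mk_out (a : FreeKBool κ X) : mk a.out = a := Quotient.out_eq a

theorem isLUB_mk_kSup (I : Set κ.out) (hI : #I < κ) (s : I → KTerm κ X) :
    IsLUB (Set.range fun i => mk (s i)) (mk (.kSup I hI s)) := by
  refine ⟨?_, ?_⟩
  · rintro _ ⟨i, rfl⟩
    exact Le.le_kSup I hI s i
  · rintro ⟨t⟩ ht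
    exact Le.kSup_le I hI s t fun i => ht ⟨i, rfl⟩

/-- Every set of cardinality `< κ` is in bijection with a subset of `κ.out`. -/
theorem exists_equiv_subset_out {ι : Type u} (hι : #ι < κ) :
    ∃ I : Set κ.out, #I < κ ∧ Nonempty (I ≃ ι) := by
  have h : #ι ≤ #κ.out := by rw [Cardinal.mk_out]; exact hι.le
  obtain ⟨e⟩ := h
  have e' : Set.range e ≃ ι := (Equiv.ofInjective e e.injective).symm
  exact ⟨Set.range e, by rwa [Cardinal.mk_congr e'], ⟨e'⟩⟩

instance instKComplete : KComplete κ (FreeKBool κ X) where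
  exists_isLUB S hS := by
    obtain ⟨I, hI, ⟨e⟩⟩ := exists_equiv_subset_out hS
    refine ⟨mk (.kSup I hI fun i => (e i : FreeKBool κ X).out), ?_⟩
    convert isLUB_mk_kSup I hI _
    ext a
    constructor
    · intro ha
      exact ⟨e.symm ⟨a, ha⟩, by simp [mk_out]⟩
    · rintro ⟨i, rfl⟩
      simp [mk_out]

/-- The generator of the free algebra given by `x : X`. -/
def of (x : X) : FreeKBool κ X := mk (.var x)

/-- A homomorphism out of the free algebra is determined by its values on the generators. -/
theorem hom_ext {A : Type u} [BooleanAlgebra A] {f g : KBoolHom κ (FreeKBool κ X) A}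
    (h : ∀ x, f (of x) = g (of x)) (a : FreeKBool κ X) : f a = g a := by
  obtain ⟨s⟩ := a
  change f (mk s) = g (mk s)
  induction s with
  | var x => exact h x
  | bot => exact f.map_bot'.trans g.map_bot'.symm
  | top => exact f.map_top'.trans g.map_top'.symm
  | compl s ih =>
    have key (k : KBoolHom κ (FreeKBool κ X) A) : k (mk (.compl s)) = (k (mk s))ᶜ :=
      map_compl' k.toBoundedLatticeHom (mk s)
    rw [key, key, ih]
  | inf s t hs ht =>
    have key (k : KBoolHom κ (FreeKBool κ X) A) : k (mk (.inf s t)) = k (mk s) ⊓ k (mk t) :=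
      k.map_inf' (mk s) (mk t)
    rw [key, key, hs, ht]
  | sup s t hs ht =>
    have key (k : KBoolHom κ (FreeKBool κ X) A) : k (mk (.sup s t)) = k (mk s) ⊔ k (mk t) :=
      k.map_sup' (mk s) (mk t)
    rw [key, key, hs, ht]
  | kSup I hI s ih =>
    have key (k : KBoolHom κ (FreeKBool κ X) A) :
        IsLUB (Set.range fun i => k (mk (s i))) (k (mk (.kSup I hI s))) := by
      have := k.map_isLUB' _ _ (mk_range_le.trans_lt hI) (isLUB_mk_kSup I hI s)
      rw [← Set.range_comp] at this
      exact this
    have hf := key f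
    simp only [ih] at hf
    exact hf.unique (key g)

section Lift

variable {A : Type u} [BooleanAlgebra A] [KComplete κ A]

/-- The value of a term under an assignment of its variables. -/
noncomputable def eval (v : X → A) : KTerm κ X → A
  | .var x => v x
  | .bot => ⊥
  | .top => ⊤
  | .compl s => (eval v s)ᶜ
  | .inf s t => eval v s ⊓ eval v t
  | .sup s t => eval v s ⊔ eval v t
  | .kSup _ hI s => KComplete.kSup κ hI fun i => eval v (s i)

theorem eval_mono (v : X → A) {s t : KTerm κ X} (h : Le s t) : eval v s ≤ eval v t := by
  induction h with
  | refl s => exact le_rfl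
  | trans _ _ h k => exact h.trans k
  | bot_le s => exact _root_.bot_le
  | le_top s => exact _root_.le_top
  | inf_le_left s t => exact _root_.inf_le_left
  | inf_le_right s t => exact _root_.inf_le_right
  | le_inf _ _ h k => exact _root_.le_inf h k
  | le_sup_left s t => exact _root_.le_sup_left
  | le_sup_right s t => exact _root_.le_sup_right
  | sup_le _ _ h k => exact _root_.sup_le h k
  | distrib s t r => exact (inf_sup_left _ _ _).le
  | inf_compl_le_bot s => exact (_root_.inf_compl_eq_bot).le
  | top_le_sup_compl s => exact (_root_.sup_compl_eq_top).ge
  | le_kSup I hI s i => exact (KComplete.isLUB_kSup κ hI fun i => eval v (s i)).1 ⟨i, rfl⟩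
  | kSup_le I hI s t _ h =>
    refine (KComplete.isLUB_kSup κ hI fun i => eval v (s i)).2 ?_
    rintro _ ⟨i, rfl⟩
    exact h i

/-- The function underlying `lift`. -/
noncomputable def liftFun (v : X → A) : FreeKBool κ X → A :=
  Quotient.lift (eval v) fun _ _ h => le_antisymm (eval_mono v h.1) (eval_mono v h.2)

theorem liftFun_mono (v : X → A) {a b : FreeKBool κ X} (h : a ≤ b) :
    liftFun v a ≤ liftFun v b := by
  obtain ⟨s⟩ := a
  obtain ⟨t⟩ := b
  exact eval_mono v h

/-- The homomorphism out of the free algebra extending a map on the generators. -/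
noncomputable def lift (v : X → A) : KBoolHom κ (FreeKBool κ X) A where
  toFun := liftFun v
  map_sup' := by rintro ⟨s⟩ ⟨t⟩; rfl
  map_inf' := by rintro ⟨s⟩ ⟨t⟩; rfl
  map_top' := rfl
  map_bot' := rfl
  map_isLUB' := by
    intro S a hS ha
    obtain ⟨I, hI, ⟨e⟩⟩ := exists_equiv_subset_out hS
    have hr : S = Set.range fun i => mk (e i : FreeKBool κ X).out := by
      ext b
      constructor
      · intro hb
        exact ⟨e.symm ⟨b, hb⟩, by simp [mk_out]⟩
      · rintro ⟨i, rfl⟩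
        simp [mk_out]
    have h := isLUB_mk_kSup I hI fun i => (e i : FreeKBool κ X).out
    rw [← hr] at h
    obtain rfl := ha.unique h
    have h' := KComplete.isLUB_kSup κ hI fun i => eval v (e i : FreeKBool κ X).out
    have hr' : liftFun v '' S = Set.range fun i => eval v (e i : FreeKBool κ X).out := by
      conv_lhs => rw [hr]
      rw [← Set.range_comp]
      rfl
    change IsLUB (liftFun v '' S) _
    rw [hr']
    exact h'

theorem lift_of (v : X → A) (x : X) : lift (κ := κ) v (of x) = v x := rfl

end Lift

/-- The homomorphism `f_*` of free algebras induced by a map `f` of generators. -/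
noncomputable def map (f : X → Y) : KBoolHom κ (FreeKBool κ X) (FreeKBool κ Y) :=
  lift fun x => of (f x)

end FreeKBool

/-! This is Beth definability for `κ`-complete Boolean algebras, deduced from Craig interpolation.
The hypothesis says that `b` determines each generator `y` outside `Z` implicitly over `Z`, so
`f_*(b ⊓ y) ≤ g_*(b ⇨ y)`. An interpolant `c y` over `Z` satisfies `b ⊓ y ≤ c y ≤ b ⇨ y`, that is,
`b ≤ c y ⇔ y`. Let `h` send `y` to `c y` and fix the generators in `Z`, and let `e` be the meet of
the `c y ⇔ y`. Below `e`, the endomorphism `i_* ∘ h` agrees with the identity on generators, hence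
everywhere (`inf_hom_congr`). As `b ≤ e`, this gives `b = e ⊓ i_* (h b)`.

Interpolation follows from amalgamation (`exists_amalgam`), which is a forcing argument. The
conditions are the pairs `(a, b)` that no element of the common domain separates, and the amalgam is
the algebra of regular lower sets of conditions. Joins of fewer than `κ` elements survive because
fewer than `κ` separators can be joined into one. -/

namespace KBoolHom

variable {κ : Cardinal.{u}} {A B C : Type u}
  [BooleanAlgebra A] [BooleanAlgebra B] [BooleanAlgebra C]

theorem isLUB_image (k : KBoolHom κ A B) {S : Set A} {a : A} (hS : #S < κ) (ha : IsLUB S a) :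
    IsLUB (k '' S) (k a) :=
  k.map_isLUB' S a hS ha

instance instBoundedLatticeHomClass : BoundedLatticeHomClass (KBoolHom κ A B) A B where
  map_sup k := k.map_sup'
  map_inf k := k.map_inf'
  map_top k := k.map_top'
  map_bot k := k.map_bot'

/-- The identity homomorphism. -/
def id (κ : Cardinal.{u}) (A : Type u) [BooleanAlgebra A] : KBoolHom κ A A where
  toBoundedLatticeHom := BoundedLatticeHom.id A
  map_isLUB' S a _ ha := by
    change IsLUB (_root_.id '' S) a
    rwa [Set.image_id]

/-- The composition of two homomorphisms. -/
def comp (l : KBoolHom κ B C) (k : KBoolHom κ A B) : KBoolHom κ A C where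
  toBoundedLatticeHom := l.toBoundedLatticeHom.comp k.toBoundedLatticeHom
  map_isLUB' S a hS ha := by
    have h := l.isLUB_image (mk_image_le.trans_lt hS) (k.isLUB_image hS ha)
    rw [← Set.image_comp] at h
    exact h

theorem id_apply (a : A) : KBoolHom.id κ A a = a := rfl

theorem comp_apply (l : KBoolHom κ B C) (k : KBoolHom κ A B) (a : A) : l.comp k a = l (k a) := rfl

/-- A map preserving the top, binary meets and joins of sets of cardinality `< κ` is a
homomorphism. -/
def ofIsLUB (hκ : ℵ₀ ≤ κ) (k : A → B) (htop : k ⊤ = ⊤) (hinf : ∀ a b, k (a ⊓ b) = k a ⊓ k b)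
    (hlub : ∀ (S : Set A) (a : A), #S < κ → IsLUB S a → IsLUB (k '' S) (k a)) :
    KBoolHom κ A B where
  toFun := k
  map_sup' a b := by
    have h := hlub {a, b} (a ⊔ b) ((Set.toFinite _).lt_aleph0.trans_le hκ) isLUB_pair
    rw [Set.image_pair] at h
    exact h.unique isLUB_pair
  map_inf' := hinf
  map_top' := htop
  map_bot' := by
    have h := hlub ∅ ⊥ ((Set.toFinite _).lt_aleph0.trans_le hκ) isLUB_empty
    rw [Set.image_empty] at h
    exact h.unique isLUB_empty
  map_isLUB' := hlub

end KBoolHom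

/-- The regular elements of a frame have all joins. -/
instance Heyting.Regular.instKComplete (κ : Cardinal.{u}) (α : Type u) [Order.Frame α] :
    KComplete κ (Heyting.Regular α) where
  exists_isLUB S _ := by
    refine ⟨Heyting.Regular.toRegular (sSup (Subtype.val '' S)), ?_, ?_⟩
    · intro a ha
      exact Heyting.Regular.coe_le_coe.1
        ((le_sSup (Set.mem_image_of_mem _ ha)).trans le_compl_compl)
    · intro t ht
      refine (Heyting.Regular.gi (α := α)).gc.l_le (sSup_le ?_)
      rintro _ ⟨a, ha, rfl⟩
      exact Heyting.Regular.coe_le_coe.2 (ht ha)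

theorem Heyting.Regular.toRegular_inf {α : Type u} [HeytingAlgebra α] (a b : α) :
    Heyting.Regular.toRegular (a ⊓ b) =
      Heyting.Regular.toRegular a ⊓ Heyting.Regular.toRegular b :=
  Heyting.Regular.coe_injective (compl_compl_inf_distrib a b)

theorem Heyting.Regular.toRegular_eq_bot {α : Type u} [HeytingAlgebra α] {a : α} :
    Heyting.Regular.toRegular a = ⊥ ↔ a = ⊥ := by
  rw [← Heyting.Regular.coe_inj, Heyting.Regular.coe_toRegular, Heyting.Regular.coe_bot]
  refine ⟨fun h => eq_bot_iff.2 (le_compl_compl.trans h.le), ?_⟩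
  rintro rfl
  rw [compl_bot, compl_top]

/-! ## Homomorphisms to algebras of regular open sets -/

section Generic

variable {κ : Cardinal.{u}} {A Q : Type u} [BooleanAlgebra A] [Preorder Q]

/-- The set of conditions `q` whose value `π q` is below `a`. -/
def lowerPreimage (π : Q →o A) (a : A) : LowerSet Q where
  carrier := {q | π q ≤ a}
  lower' _ _ h hq := (π.monotone h).trans hq

/-- The homomorphism to regular open sets of conditions given by a monotone map `π` for which a
join of fewer than `κ` elements can only be forced by forcing one of them. -/
def genericHom (hκ : ℵ₀ ≤ κ) (π : Q →o A)
    (hπ : ∀ (S : Set A) (a : A), #S < κ → IsLUB S a → ∀ q, π q ≤ a →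
      ∃ p ∈ S, ∃ r ≤ q, π r ≤ p) :
    KBoolHom κ A (Heyting.Regular (LowerSet Q)) :=
  .ofIsLUB hκ (fun a => Heyting.Regular.toRegular (lowerPreimage π a))
    (by
      have h : lowerPreimage π ⊤ = ⊤ := by ext q; simp [lowerPreimage]
      rw [h]
      exact Heyting.Regular.coe_injective (by simp))
    (fun a b => by
      have h : lowerPreimage π (a ⊓ b) = lowerPreimage π a ⊓ lowerPreimage π b := by
        ext q
        exact le_inf_iff
      rw [h]
      exact Heyting.Regular.toRegular_inf _ _)
    (fun S a hS ha => by
      refine ⟨?_, ?_⟩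
      · rintro _ ⟨p, hp, rfl⟩
        refine Heyting.Regular.toRegular.monotone ?_
        intro q hq
        exact le_trans (α := A) hq (ha.1 hp)
      · intro t ht
        refine (Heyting.Regular.gi (α := LowerSet Q)).gc.l_le ?_
        change lowerPreimage π a ≤ (t : LowerSet Q)
        -- Since `t` is regular, it suffices that no `q` below `a` lies in `tᶜ`. Such a `q` would
        -- have an extension `r` below some `p ∈ S`, and `r` would lie in both `t` and `tᶜ`.
        refine le_trans (le_compl_iff_disjoint_right.2 (disjoint_iff_inf_le.2 ?_)) t.2.eq.le
        rintro q ⟨hq, hqt⟩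
        obtain ⟨p, hp, r, hr, hrp⟩ := hπ S a hS ha q hq
        have h1 : lowerPreimage π p ≤ (t : LowerSet Q) :=
          le_compl_compl.trans (Heyting.Regular.coe_le_coe.2 (ht ⟨p, hp, rfl⟩))
        have h2 : r ∈ (t : LowerSet Q) ⊓ (t : LowerSet Q)ᶜ :=
          ⟨h1 hrp, ((t : LowerSet Q)ᶜ).lower hr hqt⟩
        rw [inf_compl_self] at h2
        exact h2.elim)

/-- Regularization preserves binary meets and sends only `⊥` to `⊥`, so disjointness can be tested
on single conditions. -/
theorem genericHom_inf_eq_bot_iff {B : Type u} [BooleanAlgebra B] (hκ : ℵ₀ ≤ κ)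
    (π : Q →o A) (hπ) (ρ : Q →o B) (hρ) (a : A) (b : B) :
    genericHom hκ π hπ a ⊓ genericHom hκ ρ hρ b = ⊥ ↔ ∀ q, π q ≤ a → ¬ ρ q ≤ b := by
  have h : genericHom hκ π hπ a ⊓ genericHom hκ ρ hρ b =
      Heyting.Regular.toRegular (lowerPreimage π a ⊓ lowerPreimage ρ b) :=
    (Heyting.Regular.toRegular_inf _ _).symm
  rw [h, Heyting.Regular.toRegular_eq_bot, eq_bot_iff]
  exact ⟨fun h q hq hq' => h ⟨hq, hq'⟩, fun h q hq => h q hq.1 hq.2⟩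

end Generic

/-! ## Amalgamation and interpolation -/

section Amalgamation

variable {κ : Cardinal.{u}} {A B C : Type u}
  [BooleanAlgebra A] [BooleanAlgebra B] [BooleanAlgebra C]

/-- Pairs of elements that are not separated by an element of `C`. -/
def Unseparated (i : KBoolHom κ C A) (j : KBoolHom κ C B) : Type u :=
  {p : A × B // ∀ c, p.1 ≤ i c → ¬ Disjoint p.2 (j c)}

namespace Unseparated

variable (i : KBoolHom κ C A) (j : KBoolHom κ C B)

instance : PartialOrder (Unseparated i j) := inferInstanceAs (PartialOrder (Subtype _))

/-- The first component. -/
def fst : Unseparated i j →o A := ⟨fun p => p.1.1, fun _ _ h => h.1⟩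

/-- The second component. -/
def snd : Unseparated i j →o B := ⟨fun p => p.1.2, fun _ _ h => h.2⟩

variable {i j} [KComplete κ C]

/-- Otherwise every `q.1.1 ⊓ p` with `p ∈ S` is separated from `q.1.2` by some `c p`; the join of
the `c p` then separates `q` itself. -/
theorem exists_fst_le (S : Set A) (a : A) (hS : #S < κ) (ha : IsLUB S a) (q : Unseparated i j)
    (hq : fst i j q ≤ a) : ∃ p ∈ S, ∃ r ≤ q, fst i j r ≤ p := by
  by_contra! H
  have key : ∀ p : S, ∃ c, q.1.1 ⊓ p ≤ i c ∧ Disjoint q.1.2 (j c) := by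
    intro p
    by_contra! h
    exact H p p.2 ⟨(q.1.1 ⊓ p, q.1.2), h⟩ ⟨inf_le_left, le_rfl⟩ inf_le_right
  choose c hc hcq using key
  obtain ⟨d, hd⟩ := KComplete.exists_isLUB_range κ hS c
  have hdi := i.isLUB_image (mk_range_le.trans_lt hS) hd
  have hdj := j.isLUB_image (mk_range_le.trans_lt hS) hd
  refine q.2 d ?_ ?_
  · have h : a ≤ q.1.1 ⇨ i d := ha.2 fun p hp => le_himp_iff'.2
      ((hc ⟨p, hp⟩).trans (hdi.1 ⟨_, ⟨_, rfl⟩, rfl⟩))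
    exact (le_inf le_rfl hq).trans (le_himp_iff'.1 h)
  · refine le_compl_iff_disjoint_left.1 (hdj.2 ?_)
    rintro _ ⟨_, ⟨p, rfl⟩, rfl⟩
    exact le_compl_iff_disjoint_left.2 (hcq p)

theorem exists_snd_le (S : Set B) (b : B) (hS : #S < κ) (hb : IsLUB S b) (q : Unseparated i j)
    (hq : snd i j q ≤ b) : ∃ p ∈ S, ∃ r ≤ q, snd i j r ≤ p := by
  by_contra! H
  -- Here `c` is the complement of a separator, so that the separators are again combined by a join
  -- rather than a meet.
  have key : ∀ p : S, ∃ c, q.1.1 ≤ i cᶜ ∧ q.1.2 ⊓ p ≤ j c := by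
    intro p
    by_contra! h
    refine H p p.2 ⟨(q.1.1, q.1.2 ⊓ p), fun c hc hd => ?_⟩ ⟨le_rfl, inf_le_left⟩ inf_le_right
    refine h cᶜ (by rwa [compl_compl]) ?_
    rw [map_compl']
    exact le_compl_iff_disjoint_right.2 hd
  choose c hcq hc using key
  obtain ⟨d, hd⟩ := KComplete.exists_isLUB_range κ hS c
  have hdi := i.isLUB_image (mk_range_le.trans_lt hS) hd
  have hdj := j.isLUB_image (mk_range_le.trans_lt hS) hd
  refine q.2 dᶜ ?_ ?_
  · rw [map_compl']
    refine le_compl_comm.1 (hdi.2 ?_)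
    rintro _ ⟨_, ⟨p, rfl⟩, rfl⟩
    have := hcq p
    rw [map_compl'] at this
    exact le_compl_comm.1 this
  · rw [map_compl', ← le_compl_iff_disjoint_right, compl_compl]
    have h : b ≤ q.1.2 ⇨ j d := hb.2 fun p hp => le_himp_iff'.2
      ((hc ⟨p, hp⟩).trans (hdj.1 ⟨_, ⟨_, rfl⟩, rfl⟩))
    exact (le_inf le_rfl hq).trans (le_himp_iff'.1 h)

end Unseparated

/-- Two homomorphisms with a common domain can be completed to a commutative square in which only
separated pairs of elements become disjoint. -/
theorem exists_amalgam [KComplete κ C] (hκ : ℵ₀ ≤ κ) (i : KBoolHom κ C A) (j : KBoolHom κ C B) :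
    ∃ (D : Type u) (_ : BooleanAlgebra D) (_ : KComplete κ D)
      (k : KBoolHom κ A D) (l : KBoolHom κ B D), (∀ c, k (i c) = l (j c)) ∧
      ∀ a b, Disjoint (k a) (l b) → ∃ c, a ≤ i c ∧ Disjoint b (j c) := by
  let k := genericHom hκ (Unseparated.fst i j) Unseparated.exists_fst_le
  let l := genericHom hκ (Unseparated.snd i j) Unseparated.exists_snd_le
  -- A condition below both `i c` and `j cᶜ` would be separated by `c`. The reverse inequality is
  -- this one at `cᶜ`.
  have hle : ∀ c, k (i c) ≤ l (j c) := by
    intro c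
    have h : k (i c) ⊓ l (j cᶜ) = ⊥ := by
      refine (genericHom_inf_eq_bot_iff hκ _ _ _ _ _ _).2 fun q hq hq' => q.2 c hq ?_
      rw [map_compl'] at hq'
      exact le_compl_iff_disjoint_right.1 hq'
    rw [map_compl', map_compl'] at h
    exact disjoint_compl_right_iff.1 (disjoint_iff.2 h)
  refine ⟨_, inferInstance, inferInstance, k, l, fun c => (hle c).antisymm ?_, ?_⟩
  · have h := hle cᶜ
    simp only [map_compl'] at h
    exact compl_le_compl_iff_le.1 h
  -- If `(a, b)` were unseparated, it would itself be a condition witnessing that `k a` and `l b`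
  -- meet.
  · intro a b h
    by_contra! H
    exact (genericHom_inf_eq_bot_iff hκ _ _ _ _ _ _).1 h.eq_bot ⟨(a, b), H⟩ le_rfl le_rfl

end Amalgamation

namespace FreeKBool

variable {κ : Cardinal.{u}} {X Y W : Type u}

theorem map_of (f : X → Y) (x : X) : map (κ := κ) f (of x) = of (f x) := rfl

theorem lift_map {A : Type u} [BooleanAlgebra A] [KComplete κ A] (v : Y → A) (f : X → Y)
    (k : KBoolHom κ (FreeKBool κ X) A) (h : ∀ x, v (f x) = k (of x)) (a : FreeKBool κ X) :
    lift v (map f a) = k a :=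
  hom_ext (f := (lift v).comp (map f)) h a

/-- Craig interpolation for free `κ`-complete Boolean algebras. -/
theorem interpolation (hκ : ℵ₀ ≤ κ) {P : Type u} {i : W → X} {j : W → Y} {f : X → P} {g : Y → P}
    (hP : IsPushout (TypeCat.ofHom i) (TypeCat.ofHom j) (TypeCat.ofHom f) (TypeCat.ofHom g))
    {a : FreeKBool κ X} {b : FreeKBool κ Y} (h : map f a ≤ map g b) :
    ∃ c : FreeKBool κ W, a ≤ map i c ∧ map j c ≤ b := by
  obtain ⟨D, _, _, k, l, hkl, hsep⟩ := exists_amalgam hκ (map (κ := κ) i) (map j)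
  -- The assignment glued along the pushout carries the inequality from the free algebra on `P` to
  -- the amalgam `D`.
  obtain ⟨v, hvf, hvg⟩ : ∃ v : P → D, (∀ x, v (f x) = k (of x)) ∧ ∀ y, v (g y) = l (of y) := by
    let v := hP.desc (TypeCat.ofHom fun x => k (of x)) (TypeCat.ofHom fun y => l (of y))
      (by ext w; exact hkl (of w))
    exact ⟨v, fun x => ConcreteCategory.congr_hom (hP.inl_desc _ _ _) x,
      fun y => ConcreteCategory.congr_hom (hP.inr_desc _ _ _) y⟩
  have hle : k a ≤ l b := by
    rw [← lift_map v f k hvf, ← lift_map v g l hvg]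
    exact OrderHomClass.mono (lift (κ := κ) v) h
  obtain ⟨c, hac, hbc⟩ := hsep a bᶜ (by
    rw [map_compl', ← le_compl_iff_disjoint_right, compl_compl]
    exact hle)
  exact ⟨c, hac, disjoint_compl_left_iff.1 hbc⟩

/-- Two homomorphisms that agree below `e` on the generators agree below `e`. -/
theorem inf_hom_congr {A : Type u} [BooleanAlgebra A] {k l : KBoolHom κ (FreeKBool κ X) A} {e : A}
    (h : ∀ x, e ⊓ k (of x) = e ⊓ l (of x)) (a : FreeKBool κ X) : e ⊓ k a = e ⊓ l a := by
  obtain ⟨s⟩ := a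
  change e ⊓ k (mk s) = e ⊓ l (mk s)
  induction s with
  | var x => exact h x
  | bot =>
    change e ⊓ k ⊥ = e ⊓ l ⊥
    rw [map_bot, map_bot]
  | top =>
    change e ⊓ k ⊤ = e ⊓ l ⊤
    rw [map_top, map_top]
  | compl s ih =>
    change e ⊓ k (mk s)ᶜ = e ⊓ l (mk s)ᶜ
    -- `e \ x` depends only on `e ⊓ x`.
    rw [map_compl', map_compl', ← sdiff_eq, ← sdiff_eq, ← sdiff_inf_self_left, ih,
      sdiff_inf_self_left]
  | inf s t hs ht =>
    change e ⊓ k (mk s ⊓ mk t) = e ⊓ l (mk s ⊓ mk t)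
    rw [map_inf, map_inf, inf_inf_distrib_left, hs, ht, ← inf_inf_distrib_left]
  | sup s t hs ht =>
    change e ⊓ k (mk s ⊔ mk t) = e ⊓ l (mk s ⊔ mk t)
    rw [map_sup, map_sup, inf_sup_left, hs, ht, ← inf_sup_left]
  | kSup I hI s ih =>
    have key {k l : KBoolHom κ (FreeKBool κ X) A}
        (ih : ∀ i, e ⊓ k (mk (s i)) = e ⊓ l (mk (s i))) :
        e ⊓ k (mk (.kSup I hI s)) ≤ e ⊓ l (mk (.kSup I hI s)) := by
      have hk := k.isLUB_image (mk_range_le.trans_lt hI) (isLUB_mk_kSup I hI s)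
      have hl := l.isLUB_image (mk_range_le.trans_lt hI) (isLUB_mk_kSup I hI s)
      refine le_inf inf_le_left (le_himp_iff'.1 (hk.2 ?_))
      rintro _ ⟨_, ⟨i, rfl⟩, rfl⟩
      refine le_himp_iff'.2 ((ih i).le.trans (inf_le_right.trans ?_))
      exact hl.1 ⟨_, ⟨i, rfl⟩, rfl⟩
    exact le_antisymm (key ih) (key fun i => (ih i).symm)

end FreeKBool

/-! ### Explicit definitions from implicit ones -/

theorem le_bihimp_iff_inf_eq {A : Type u} [GeneralizedHeytingAlgebra A] {e a b : A} :
    e ≤ a ⇔ b ↔ e ⊓ a = e ⊓ b := by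
  rw [le_bihimp_iff]
  exact ⟨fun h => le_antisymm (le_inf inf_le_left (inf_comm e a ▸ h.2))
      (le_inf inf_le_left (inf_comm e b ▸ h.1)),
    fun h => ⟨inf_comm e b ▸ h.ge.trans inf_le_right, inf_comm e a ▸ h.le.trans inf_le_right⟩⟩

theorem mainTheorem8 (κ : Cardinal.{u}) (hκ : κ.IsRegular)
    (X : Type u) (hX : #X < κ) (Z : Set X)
    (P : Type u) (f g : X → P)
    (hP : IsPushout (TypeCat.ofHom (Subtype.val : Z → X)) (TypeCat.ofHom (Subtype.val : Z → X))
      (TypeCat.ofHom f) (TypeCat.ofHom g))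
    (b : FreeKBool κ X)
    (hb : FreeKBool.map f b ⊓ FreeKBool.map g b ≤
      KComplete.kInf κ ((mk_set_le (Zᶜ : Set X)).trans_lt hX)
        (fun y : (Zᶜ : Set X) =>
          (FreeKBool.of (f y) : FreeKBool κ P) ⇔ FreeKBool.of (g y))) :
    ∃ h : KBoolHom κ (FreeKBool κ X) (FreeKBool κ Z),
      (∀ a : FreeKBool κ Z, h (FreeKBool.map (Subtype.val : Z → X) a) = a) ∧
      b = FreeKBool.map (Subtype.val : Z → X) (h b) ⊓
        KComplete.kInf κ ((mk_set_le (Zᶜ : Set X)).trans_lt hX)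
          (fun y : (Zᶜ : Set X) =>
            FreeKBool.map (Subtype.val : Z → X) (h (FreeKBool.of (y : X))) ⇔
              FreeKBool.of (y : X)) := by
  have hκ' := hκ.aleph0_le
  have hy : ∀ y : X, ∃ c : FreeKBool κ Z, (∀ hz : y ∈ Z, c = FreeKBool.of ⟨y, hz⟩) ∧
      b ≤ FreeKBool.map Subtype.val c ⇔ FreeKBool.of y := by
    intro y
    by_cases hz : y ∈ Z
    -- This choice on `Z` makes `h` a retraction of `i_*`.
    · refine ⟨FreeKBool.of ⟨y, hz⟩, fun _ => rfl, ?_⟩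
      rw [FreeKBool.map_of, bihimp_self]
      exact le_top
    · have h1 := hb.trans ((KComplete.isGLB_kInf κ _ _).1 ⟨⟨y, hz⟩, rfl⟩)
      rw [le_bihimp_iff] at h1
      -- One implication of the biconditional suffices: the two bounds on the interpolant give both
      -- implications between `c` and `y` below `b`.
      obtain ⟨c, hc, hc'⟩ := FreeKBool.interpolation (κ := κ) hκ' hP
        (a := b ⊓ FreeKBool.of y) (b := b ⇨ FreeKBool.of y) (by
          rw [himp_eq, map_sup, map_compl', ← himp_eq, map_inf, le_himp_iff, FreeKBool.map_of,
            FreeKBool.map_of, inf_right_comm, inf_comm]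
          exact h1.2)
      refine ⟨c, fun h => absurd h hz, le_bihimp_iff.2 ⟨?_, le_himp_iff.1 hc'⟩⟩
      rw [inf_comm]
      exact hc
  choose c hcZ hcb using hy
  let h : KBoolHom κ (FreeKBool κ X) (FreeKBool κ Z) := FreeKBool.lift c
  have hof (x : X) : h (FreeKBool.of x) = c x := rfl
  refine ⟨h, fun a => FreeKBool.lift_map c Subtype.val (KBoolHom.id κ _)
    (fun z => hcZ z z.2) a, ?_⟩
  set e := KComplete.kInf κ ((mk_set_le (Zᶜ : Set X)).trans_lt hX) (fun y : (Zᶜ : Set X) =>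
    FreeKBool.map (Subtype.val : Z → X) (h (FreeKBool.of (y : X))) ⇔ FreeKBool.of (y : X)) with he
  have hglb : IsGLB _ e := KComplete.isGLB_kInf κ _ _
  have hbe : b ≤ e := hglb.2 (by rintro _ ⟨y, rfl⟩; exact hcb y)
  have hcongr := FreeKBool.inf_hom_congr (e := e) (k := (FreeKBool.map Subtype.val).comp h)
    (l := KBoolHom.id κ _) (fun x => by
      rw [← le_bihimp_iff_inf_eq, KBoolHom.comp_apply, KBoolHom.id_apply]
      by_cases hz : x ∈ Z
      · rw [hof, hcZ x hz, FreeKBool.map_of, bihimp_self]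
        exact le_top
      · exact hglb.1 ⟨⟨x, hz⟩, rfl⟩) b
  rw [KBoolHom.comp_apply, KBoolHom.id_apply, inf_eq_right.2 hbe] at hcongr
  rw [inf_comm, hcongr]
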